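/- Let $\mathcal H$ be a complex Hilbert space, let $r>0$ and $\mathbb D_r=\{z\in\mathbb C : |z|<r\}$, and let $K\colon \mathbb D_r\times\mathbb D_r\to\mathcal L(\mathcal H)$ be a Hermitian holomorphic kernel, that is, $K(z,w)=K(w,z)^*$ for all $z,w\in\mathbb D_r$, the map $z\mapsto K(z,w)$ is holomorphic on $\mathbb D_r$ for each $w\in\mathbb D_r$, and the map $\overline w\mapsto K(z,w)$ is holomorphic for each $z\in\mathbb D_r$ (in the operator norm). Then there exist $0<r'\le r$ and a reproducing kernel Kreĭn space on $\mathbb D_{r'}$ with reproducing kernel $K|_{\mathbb D_{r'}\times\mathbb D_{r'}}$. That is, there are a linear subspace $\mathcal R$ of the space of all functions $\mathbb D_{r'}\to\mathcal H$ and a Hermitian sesquilinear form $[\cdot,\cdot]$ on $\mathcal R$ such that: 1. $(\mathcal R,[\cdot,\cdot])$ is a Kreĭn space: $\mathcal R=\mathcal R_+\dotplus\mathcal R_-$ is a direct sum of linear subspaces with $[f_+,f_-]=0$ for all $f_\pm\in\mathcal R_\pm$, and $(\mathcal R_+,[\cdot,\cdot])$ and $(\mathcal R_-,-[\cdot,\cdot])$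 are Hilbert spaces; 2. for all $w\in\mathbb D_{r'}$ and $h\in\mathcal H$, the function $K(\cdot,w)h\colon z\mapsto K(z,w)h$ on $\mathbb D_{r'}$ belongs to $\mathcal R$; 3. $\langle f(w),h\rangle_{\mathcal H}=[f,K(\cdot,w)h]$ for all $f\in\mathcal R$, $w\in\mathbb D_{r'}$ and $h\in\mathcal H$. -/

import Mathlib

open scoped ComplexConjugate

/-- `b` (linear in the first, conjugate linear in the second argument) is the inner product of a
Hilbert space structure on the complex vector space `V`: it is a positive definite inner product,
and `V` is complete for the norm that it induces. Mathlib's inner products are linear in the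
second argument, whence the exchange of `x` and `y`. -/
def IsHilbertInnerProduct {V : Type*} [AddCommGroup V] [Module ℂ V] (b : V → V → ℂ) : Prop :=
  ∃ c : InnerProductSpace.Core ℂ V, (∀ x y : V, c.inner y x = b x y) ∧
    letI : NormedAddCommGroup V := @InnerProductSpace.Core.toNormedAddCommGroup ℂ V _ _ _ c
    CompleteSpace V

/-- `(V, [·,·])` is a Krein space: `[·,·]` is a Hermitian sesquilinear form (linear in the first
argument), and `V` is the direct sum of two `[·,·]`-orthogonal subspaces `P` and `N` such that
`(P, [·,·])` and `(N, -[·,·])` are Hilbert spaces. -/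
def IsKreinSpace {V : Type*} [AddCommGroup V] [Module ℂ V] (B : V →ₗ[ℂ] V →ₗ⋆[ℂ] ℂ) : Prop :=
  (∀ x y : V, B y x = conj (B x y)) ∧
    ∃ P N : Submodule ℂ V, IsCompl P N ∧
      (∀ x ∈ P, ∀ y ∈ N, B x y = 0) ∧
      IsHilbertInnerProduct (fun x y : P => B (x : V) (y : V)) ∧
      IsHilbertInnerProduct (fun x y : N => -B (x : V) (y : V))

section Kernels

variable {H : Type*} [NormedAddCommGroup H] [InnerProductSpace ℂ H] [CompleteSpace H]

/-- An `H`-kernel on the subset `Ω` of the plane is Hermitian if `K z w = (K w z)*` on `Ω`. -/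
def IsHermitianKernelOn (K : ℂ → ℂ → H →L[ℂ] H) (Ω : Set ℂ) : Prop :=
  ∀ z ∈ Ω, ∀ w ∈ Ω, K z w = ContinuousLinearMap.adjoint (K w z)

/-- An `H`-kernel on the open set `Ω` is holomorphic if it is holomorphic in the first variable
and conjugate holomorphic in the second one (holomorphic in `conj w`, which runs through the
complex conjugate of `Ω`), separately, for the operator norm. -/
def IsHolomorphicKernelOn (K : ℂ → ℂ → H →L[ℂ] H) (Ω : Set ℂ) : Prop :=
  (∀ w ∈ Ω, DifferentiableOn ℂ (fun z => K z w) Ω) ∧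
    ∀ z ∈ Ω, DifferentiableOn ℂ (fun v => K z (conj v)) {v : ℂ | conj v ∈ Ω}

/-- The subspace `R` of the space of all functions `X → H`, with the form `B` (linear in the first
argument), is a reproducing kernel Krein space with reproducing kernel `K`: it is a Krein space,
it contains the functions `K(·, y) h`, and `⟨f x, h⟩ = [f, K(·, x) h]` for all `f ∈ R`. -/
structure IsReproducingKernelKreinSpace {X : Type*} (K : X → X → H →L[ℂ] H)
    (R : Submodule ℂ (X → H)) (B : R →ₗ[ℂ] R →ₗ⋆[ℂ] ℂ) : Prop where
  isKreinSpace : IsKreinSpace B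
  kernel_mem : ∀ (y : X) (h : H), (fun x => K x y h) ∈ R
  reproducing : ∀ (f : R) (x : X) (h : H),
    inner ℂ h ((f : X → H) x) = B f ⟨fun z => K z x h, kernel_mem x h⟩

end Kernels

/-! Near the origin K(z,w) = ∑ a_{mn} z^m conj(w)^n. If the a_{mn} are summable in norm, they form a
bounded operator matrix on ℓ²(H), and K(z,w) = E(z) A E(w)*, where E(z) evaluates at z the power
series with given coefficients. As K is Hermitian, A may be replaced by its self-adjoint part. The
functional calculus gives A = S₁² - S₂² with S₁S₂ = 0. With Wᵢ the orthogonal complement of ker Sᵢ,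
the map (w₁, w₂) ↦ E(·)(S₁w₁ + S₂w₂) is injective and carries the Krein space W₁ ⊕ (-W₂) to the
required function space (`exists_isReproducingKernelKreinSpace_of_factorization`).

The radius shrinks twice. Halving it makes the rescaled coefficients summable. Before that, the
double series needs K to be bounded near the origin, while K is only separately holomorphic: this is
Hartogs' theorem (`exists_bound_near_zero_of_separately_holomorphic`). Baire's theorem bounds K on a
product of discs that may be off centre in the second variable. Taylor expansion about that centre,
together with the subharmonicity of log ‖·‖ (`exists_uniform_bound_of_pointwise_bound`), carries the
bound to the origin. -/

section TaylorCoefficients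

/-! ### Taylor coefficients and Cauchy estimates -/

variable {E : Type*} [NormedAddCommGroup E] [NormedSpace ℂ E]

/-- The `n`-th Taylor coefficient of `f` at the origin. -/
noncomputable def taylorCoeff (f : ℂ → E) (n : ℕ) : E :=
  (n.factorial : ℂ)⁻¹ • iteratedDeriv n f 0

variable [CompleteSpace E]

theorem hasSum_taylorCoeff {f : ℂ → E} {r : ℝ} (hf : DifferentiableOn ℂ f (Metric.ball 0 r))
    {z : ℂ} (hz : z ∈ Metric.ball 0 r) : HasSum (fun n => z ^ n • taylorCoeff f n) (f z) := by
  have h := Complex.hasSum_taylorSeries_on_ball hf hz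
  convert h using 2 with n
  rw [taylorCoeff, sub_zero, smul_comm]

theorem norm_taylorCoeff_le_of_sphere {f : ℂ → E} {r M : ℝ} (hr : 0 < r)
    (hf : DiffContOnCl ℂ f (Metric.ball 0 r)) (hM : ∀ z ∈ Metric.sphere 0 r, ‖f z‖ ≤ M) (n : ℕ) :
    ‖taylorCoeff f n‖ ≤ M / r ^ n := by
  have h := Complex.norm_iteratedDeriv_le_of_forall_mem_sphere_norm_le n hr hf hM
  have hn : (0 : ℝ) < n.factorial := by positivity
  rw [taylorCoeff, norm_smul, norm_inv, Complex.norm_natCast]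
  calc _ ≤ (n.factorial : ℝ)⁻¹ * (n.factorial * M / r ^ n) := by gcongr
    _ = M / r ^ n := by field_simp

/-- Cauchy's estimate on circles of radius s < r, letting s tend to r, so that nothing is needed on
the boundary. -/
theorem norm_taylorCoeff_le {f : ℂ → E} {r M : ℝ} (hr : 0 < r)
    (hf : DifferentiableOn ℂ f (Metric.ball 0 r)) (hM : ∀ z ∈ Metric.ball 0 r, ‖f z‖ ≤ M) (n : ℕ) :
    ‖taylorCoeff f n‖ ≤ M / r ^ n := by
  have hlim : Filter.Tendsto (fun s : ℝ => M / s ^ n) (nhdsWithin r (Set.Iio r))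
      (nhds (M / r ^ n)) := by
    have : ContinuousAt (fun s : ℝ => M / s ^ n) r :=
      ContinuousAt.div (by fun_prop) (by fun_prop) (by positivity)
    exact this.tendsto.mono_left nhdsWithin_le_nhds
  refine ge_of_tendsto hlim ?_
  filter_upwards [Ioo_mem_nhdsLT hr] with s hs
  refine norm_taylorCoeff_le_of_sphere hs.1 ?_ (fun z hz => hM z ?_) n
  · apply DifferentiableOn.diffContOnCl
    rw [closure_ball _ hs.1.ne']
    exact hf.mono (Metric.closedBall_subset_ball hs.2)
  · exact Metric.sphere_subset_closedBall.trans (Metric.closedBall_subset_ball hs.2) hz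

/-- The Taylor coefficients of a bounded separately holomorphic function depend holomorphically
on the other variable. -/
theorem differentiableOn_taylorCoeff {F : ℂ → ℂ → E} {U : Set ℂ} (hU : IsOpen U) {r M : ℝ}
    (hr : 0 < r) (hF₁ : ∀ v ∈ Metric.ball 0 r, DifferentiableOn ℂ (fun z => F z v) U)
    (hF₂ : ∀ z ∈ U, DifferentiableOn ℂ (F z) (Metric.ball 0 r))
    (hM : ∀ z ∈ U, ∀ v ∈ Metric.ball 0 r, ‖F z v‖ ≤ M) (n : ℕ) :
    DifferentiableOn ℂ (fun z => taylorCoeff (F z) n) U := by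
  induction n using Nat.strong_induction_on with
  | _ n ih =>
  -- By induction, the n-th coefficient is the limit of (F z v - ∑_{k<n} v^k c_k(z)) / v^n along v =
  -- r xⱼ → 0. These quotients are holomorphic in z, and the geometric tail bound makes the limit
  -- uniform. The shift by 2 keeps xⱼ < 1.
  set x : ℕ → ℝ := fun j => 1 / (j + 2) with hx
  have hx0 : ∀ j, 0 < x j := fun j => by simp only [hx]; positivity
  have hx1 : ∀ j, x j < 1 := fun j => by
    simp only [hx]; rw [div_lt_one (by positivity)]; linarith [(j.cast_nonneg : (0 : ℝ) ≤ j)]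
  set v : ℕ → ℂ := fun j => ((r * x j : ℝ) : ℂ) with hv
  have hvn : ∀ j, ‖v j‖ = r * x j := fun j => by
    simp only [hv, Complex.norm_real, Real.norm_eq_abs]
    exact abs_of_pos (mul_pos hr (hx0 j))
  have hvr : ∀ j, v j ∈ Metric.ball (0 : ℂ) r := fun j => by
    rw [mem_ball_zero_iff, hvn]; nlinarith [hx1 j, hx0 j]
  have hv0 : ∀ j, v j ≠ 0 := fun j => by
    rw [← norm_pos_iff, hvn]; exact mul_pos hr (hx0 j)
  set G : ℕ → ℂ → E := fun j z => (v j ^ n)⁻¹ •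
    (F z (v j) - ∑ k ∈ Finset.range n, v j ^ k • taylorCoeff (F z) k) with hG
  have hGd : ∀ j, DifferentiableOn ℂ (G j) U := fun j =>
    ((hF₁ _ (hvr j)).sub (DifferentiableOn.fun_sum fun k hk =>
      (ih k (Finset.mem_range.mp hk)).const_smul _)).const_smul _
  have hb : ∀ j, ∀ z ∈ U, ‖taylorCoeff (F z) n - G j z‖ ≤ M / r ^ n * (x j / (1 - x j)) := by
    intro j z hz
    have hs := hasSum_taylorCoeff (hF₂ z hz) (hvr j)
    have h1 := ((hasSum_nat_add_iff' n).mpr hs).const_smul (v j ^ n)⁻¹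
    have h2 : HasSum (fun k => v j ^ k • taylorCoeff (F z) (k + n)) (G j z) := by
      convert h1 using 2 with k
      rw [smul_smul, pow_add, mul_comm, mul_assoc, mul_inv_cancel₀ (pow_ne_zero _ (hv0 j)), mul_one]
    have h3 := (hasSum_nat_add_iff' 1).mpr h2
    simp only [Finset.range_one, Finset.sum_singleton, pow_zero, one_smul, zero_add] at h3
    have hgeo : HasSum (fun k : ℕ => M / r ^ n * x j * x j ^ k) (M / r ^ n * (x j / (1 - x j))) := by
      have := (hasSum_geometric_of_lt_one (hx0 j).le (hx1 j)).mul_left (M / r ^ n * x j)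
      rwa [mul_assoc, ← div_eq_mul_inv] at this
    rw [norm_sub_rev, ← h3.tsum_eq]
    refine tsum_of_norm_bounded hgeo fun k => ?_
    rw [norm_smul, norm_pow, hvn]
    calc _ ≤ (r * x j) ^ (k + 1) * (M / r ^ (k + 1 + n)) := by
          have := norm_taylorCoeff_le hr (hF₂ z hz) (hM z hz) (k + 1 + n)
          have := hx0 j
          gcongr
      _ = _ := by
        rw [mul_pow, pow_add r (k + 1) n]
        field_simp
        ring
  have hlim : Filter.Tendsto (fun j => M / r ^ n * (x j / (1 - x j))) Filter.atTop (nhds 0) := by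
    have h1 : Filter.Tendsto x Filter.atTop (nhds 0) := by
      have := (tendsto_one_div_add_atTop_nhds_zero_nat (𝕜 := ℝ)).comp (Filter.tendsto_add_atTop_nat 1)
      refine this.congr fun j => ?_
      simp only [hx, Function.comp]
      push_cast
      ring
    have h2 := (h1.div (h1.const_sub 1) (by simp)).const_mul (M / r ^ n)
    simpa using h2
  have hunif : TendstoUniformlyOn G (fun z => taylorCoeff (F z) n) Filter.atTop U := by
    rw [Metric.tendstoUniformlyOn_iff]
    intro ε hε
    filter_upwards [hlim.eventually (gt_mem_nhds hε)] with j hj z hz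
    rw [dist_eq_norm]
    exact (hb j z hz).trans_lt hj
  exact hunif.tendstoLocallyUniformlyOn.differentiableOn (Filter.Eventually.of_forall hGd) hU

end TaylorCoefficients

/-! ### Hartogs' lemma through the submean property of log ‖·‖ -/

section Hartogs

open MeasureTheory Metric

/-- The submean property of `log ‖g‖`, for `g` holomorphic. -/
theorem log_norm_le_circleAverage {g : ℂ → ℂ} {c : ℂ} {t : ℝ} (ht : 0 < t)
    (hg : AnalyticOnNhd ℂ g (closedBall c t)) (hc : g c ≠ 0) :
    Real.log ‖g c‖ ≤ Real.circleAverage (fun z => Real.log ‖g z‖) c t := by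
  rw [← abs_of_pos ht] at hg
  -- Jensen's formula: the two sides differ by a sum over the zeros u of g, with terms mult(u) ·
  -- log(t / ‖c - u‖) ≥ 0.
  rw [hg.circleAverage_log_norm ht.ne' hc, le_add_iff_nonneg_left]
  refine finsum_nonneg fun u => ?_
  by_cases hu : u ∈ closedBall c |t|
  · refine mul_nonneg ?_ ?_
    · exact_mod_cast (MeromorphicOn.AnalyticOnNhd.divisor_nonneg hg) u
    · rcases eq_or_ne u c with rfl | hne
      · simp
      · refine Real.log_nonneg ?_
        have h0 : 0 < ‖c - u‖ := by rwa [norm_pos_iff, sub_ne_zero, ne_comm]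
        rw [← div_eq_mul_inv, one_le_div h0]
        rwa [mem_closedBall, dist_comm, dist_eq_norm, abs_of_pos ht] at hu
  · rw [Function.locallyFinsuppWithin.apply_eq_zero_of_notMem _ hu]
    simp

variable {E : Type*} [NormedAddCommGroup E] [NormedSpace ℂ E]

/-- A two constants estimate on a circle, for vector valued holomorphic functions. -/
theorem log_norm_le_mul_circleAverage_indicator {f : ℂ → E} {c : ℂ} {s t Λ : ℝ} (ht : 0 < t)
    (hts : t < s) (hf : DifferentiableOn ℂ f (ball c s)) (hc : f c ≠ 0) {S : Set ℂ}
    (hS : MeasurableSet S) (hΛ : 0 ≤ Λ) (h1 : ∀ z ∈ sphere c t, z ∉ S → ‖f z‖ ≤ 1)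
    (h2 : ∀ z ∈ sphere c t, ‖f z‖ ≤ Real.exp Λ) :
    Real.log ‖f c‖ ≤ Λ * Real.circleAverage (S.indicator fun _ => (1 : ℝ)) c t := by
  -- A norming functional at f c reduces the estimate to the scalar function l ∘ f.
  obtain ⟨l, hl, hlc⟩ := exists_dual_vector ℂ (f c) (norm_ne_zero_iff.mpr hc)
  have hgn : ∀ z, ‖l (f z)‖ ≤ ‖f z‖ := fun z => by
    simpa [hl] using l.le_opNorm (f z)
  have hgd : DifferentiableOn ℂ (fun z => l (f z)) (ball c s) :=
    l.differentiable.comp_differentiableOn hf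
  have hga : AnalyticOnNhd ℂ (fun z => l (f z)) (closedBall c t) :=
    (hgd.analyticOnNhd isOpen_ball).mono (closedBall_subset_ball hts)
  have hlc' : ‖l (f c)‖ = ‖f c‖ := by rw [hlc]; simp
  have hint : CircleIntegrable (S.indicator fun _ => (1 : ℝ)) c t := by
    have hm : MeasurableSet (circleMap c t ⁻¹' S) := (continuous_circleMap c t).measurable hS
    have : (fun θ => S.indicator (fun _ => (1 : ℝ)) (circleMap c t θ))
        = (circleMap c t ⁻¹' S).indicator fun _ => (1 : ℝ) := rfl
    rw [CircleIntegrable, this, intervalIntegrable_iff]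
    exact IntegrableOn.indicator (intervalIntegrable_const (c := (1 : ℝ))).def' hm
  have hlog : CircleIntegrable (fun z => Real.log ‖l (f z)‖) c t := by
    refine MeromorphicOn.circleIntegrable_log_norm fun z hz => ?_
    rw [abs_of_pos ht] at hz
    exact (hga z (sphere_subset_closedBall hz)).meromorphicAt
  calc Real.log ‖f c‖ = Real.log ‖l (f c)‖ := by rw [hlc']
    _ ≤ Real.circleAverage (fun z => Real.log ‖l (f z)‖) c t :=
      log_norm_le_circleAverage ht hga (by rw [← norm_pos_iff, hlc']; exact norm_pos_iff.mpr hc)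
    _ ≤ Real.circleAverage (Λ • S.indicator fun _ => (1 : ℝ)) c t := by
      refine Real.circleAverage_mono hlog hint.const_smul fun z hz => ?_
      rw [abs_of_pos ht] at hz
      by_cases hzS : z ∈ S
      · simp only [Pi.smul_apply, Set.indicator_of_mem hzS, smul_eq_mul, mul_one]
        rcases (norm_nonneg (l (f z))).eq_or_lt with h0 | h0
        · rw [← h0]; simpa
        · rw [Real.log_le_iff_le_exp h0]
          exact (hgn z).trans (h2 z hz)
      · simp only [Pi.smul_apply, Set.indicator_of_notMem hzS, smul_zero]
        exact Real.log_nonpos (norm_nonneg _) ((hgn z).trans (h1 z hz hzS))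
    _ = _ := by rw [Real.circleAverage_smul, smul_eq_mul]

/-- A set of small area meets some circle around any given point in a set of small angle. -/
theorem exists_circleAverage_indicator_le {S : Set ℂ} (hS : MeasurableSet S) (c : ℂ) {s κ : ℝ}
    (hs : 0 < s) (hκ : 0 < κ) (hvol : volume S < ENNReal.ofReal (κ * s ^ 2 / 4)) :
    ∃ t ∈ Set.Ioo (s / 2) s, Real.circleAverage (S.indicator fun _ => (1 : ℝ)) c t ≤ κ := by
  -- Otherwise each circle of radius t in (s/2, s) meets S in angle more than 2πκ ≥ κ, and polar
  -- coordinates give S area at least (s/2) · (s/2) · κ.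
  by_contra! hcon
  have hπ := Real.pi_pos
  refine hvol.not_ge ?_
  have hang : ∀ t ∈ Set.Ioo (s / 2) s, ENNReal.ofReal κ ≤
      ∫⁻ θ in Set.Ioo (-Real.pi) Real.pi,
        S.indicator (fun _ => (1 : ENNReal)) (c + Complex.polarCoord.symm (t, θ)) := by
    intro t ht
    have hcm : ∀ θ, c + Complex.polarCoord.symm (t, θ) = circleMap c t θ := fun θ => by
      rw [Complex.polarCoord_symm_apply, circleMap, Complex.exp_mul_I, Complex.ofReal_cos,
        Complex.ofReal_sin]
    have h := hcon t ht
    rw [Real.circleAverage_eq_integral_add (-Real.pi),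
      intervalIntegral.integral_comp_add_right
        (fun θ => S.indicator (fun _ => (1 : ℝ)) (circleMap c t θ)),
      show 0 + -Real.pi = -Real.pi by ring, show 2 * Real.pi + -Real.pi = Real.pi by ring,
      intervalIntegral.integral_of_le (by linarith), integral_Ioc_eq_integral_Ioo, smul_eq_mul,
      inv_mul_eq_div, lt_div_iff₀ (by positivity)] at h
    have hm : MeasurableSet (circleMap c t ⁻¹' S) := (continuous_circleMap c t).measurable hS
    have hi : Integrable (fun θ => S.indicator (fun _ => (1 : ℝ)) (circleMap c t θ))
        (volume.restrict (Set.Ioo (-Real.pi) Real.pi)) :=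
      (integrable_const (1 : ℝ)).indicator hm
    calc ENNReal.ofReal κ ≤ ENNReal.ofReal (∫ θ in Set.Ioo (-Real.pi) Real.pi,
          S.indicator (fun _ => (1 : ℝ)) (circleMap c t θ)) := by
          refine ENNReal.ofReal_le_ofReal (le_trans ?_ h.le)
          nlinarith [Real.two_le_pi]
      _ = _ := by
        rw [ofReal_integral_eq_lintegral_ofReal hi
          (Filter.Eventually.of_forall fun θ => Set.indicator_nonneg (fun _ _ => zero_le_one) _)]
        refine lintegral_congr fun θ => ?_
        rw [hcm]
        by_cases h : circleMap c t θ ∈ S <;> simp [h]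
  have hmeas : Measurable fun p : ℝ × ℝ => ENNReal.ofReal p.1 •
      S.indicator (fun _ => (1 : ENNReal)) (c + Complex.polarCoord.symm p) := by
    refine Measurable.smul (ENNReal.measurable_ofReal.comp measurable_fst) ?_
    refine (measurable_const.indicator hS).comp (measurable_const.add ?_)
    have : ⇑Complex.polarCoord.symm = fun p : ℝ × ℝ =>
        (p.1 : ℂ) * (Real.cos p.2 + Real.sin p.2 * Complex.I) :=
      funext Complex.polarCoord_symm_apply
    rw [this]
    fun_prop
  have hs2 : (0 : ℝ) ≤ s / 2 := by positivity
  calc ENNReal.ofReal (κ * s ^ 2 / 4)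
      = ∫⁻ t in Set.Ioo (s / 2) s, ENNReal.ofReal (s / 2) * ENNReal.ofReal κ := by
        rw [setLIntegral_const, Real.volume_Ioo, ← ENNReal.ofReal_mul hs2,
          ← ENNReal.ofReal_mul (by positivity)]
        congr 1; ring
    _ ≤ ∫⁻ t in Set.Ioo (s / 2) s, ∫⁻ θ in Set.Ioo (-Real.pi) Real.pi, ENNReal.ofReal t •
          S.indicator (fun _ => (1 : ENNReal)) (c + Complex.polarCoord.symm (t, θ)) := by
        refine setLIntegral_mono' measurableSet_Ioo fun t ht => ?_
        simp only [smul_eq_mul]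
        rw [lintegral_const_mul' _ _ ENNReal.ofReal_ne_top]
        exact mul_le_mul' (ENNReal.ofReal_le_ofReal ht.1.le) (hang t ht)
    _ ≤ ∫⁻ t in Set.Ioi 0, ∫⁻ θ in Set.Ioo (-Real.pi) Real.pi, ENNReal.ofReal t •
          S.indicator (fun _ => (1 : ENNReal)) (c + Complex.polarCoord.symm (t, θ)) :=
        lintegral_mono_set fun t ht => lt_of_le_of_lt hs2 ht.1
    _ = ∫⁻ p in polarCoord.target, ENNReal.ofReal p.1 •
          S.indicator (fun _ => (1 : ENNReal)) (c + Complex.polarCoord.symm p) := by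
        rw [polarCoord_target, Measure.volume_eq_prod,
          setLIntegral_prod _ hmeas.aemeasurable]
    _ = ∫⁻ z, S.indicator (fun _ => (1 : ENNReal)) (c + z) :=
        Complex.lintegral_comp_polarCoord_symm
          (fun z => S.indicator (fun _ => (1 : ENNReal)) (c + z))
    _ = ∫⁻ z, S.indicator (fun _ => (1 : ENNReal)) z :=
        lintegral_add_left_eq_self (S.indicator fun _ => (1 : ENNReal)) c
    _ = volume S := by rw [lintegral_indicator_const hS, one_mul]

/-- **Hartogs' lemma**: pointwise exponential bounds for a sequence of holomorphic functions are
locally uniform when some uniform exponential bound is known. -/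
theorem exists_uniform_bound_of_pointwise_bound {c : ℕ → ℂ → E} {ρ M δ Q R : ℝ} (hρ : 0 < ρ)
    (hδ : 0 < δ) (hQ : 0 < Q) (hQR : Q < R) (hc : ∀ n, DifferentiableOn ℂ (c n) (ball 0 ρ))
    (hM : ∀ n, ∀ z ∈ ball 0 ρ, ‖c n z‖ ≤ M / δ ^ n)
    (hR : ∀ z ∈ ball 0 ρ, ∃ C, ∀ n, ‖c n z‖ ≤ C / R ^ n) :
    ∃ C, ∀ n, ∀ z ∈ ball 0 (ρ / 2), ‖c n z‖ ≤ C / Q ^ n := by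
  have hR0 : 0 < R := hQ.trans hQR
  -- If R ≤ δ the given uniform bound suffices; otherwise log (R / δ) > 0, as needed for dividing by
  -- it below.
  rcases le_or_gt R δ with hRδ | hδR
  · have hM0 : 0 ≤ M := by
      have := (norm_nonneg _).trans (hM 0 0 (mem_ball_self hρ))
      simpa using this
    refine ⟨M, fun n z hz => (hM n z (ball_subset_ball (by linarith) hz)).trans ?_⟩
    have : Q ≤ δ := hQR.le.trans hRδ
    gcongr
  -- The exceptional sets, where the bound k / R^n fails for some n. They decrease to ∅ by the
  -- pointwise bounds, so their areas tend to 0.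
  set S : ℕ → Set ℂ := fun k => ⋃ n, ball 0 ρ ∩ (c n ⁻¹' {x | (k : ℝ) / R ^ n < ‖x‖}) with hSdef
  have hSo : ∀ k, IsOpen (S k) := fun k => isOpen_iUnion fun n =>
    (hc n).continuousOn.isOpen_inter_preimage isOpen_ball
      (isOpen_lt continuous_const continuous_norm)
  have hSanti : Antitone S := by
    intro k l hkl z hz
    obtain ⟨n, hn, hz⟩ := Set.mem_iUnion.mp hz
    have hle : (k : ℝ) / R ^ n ≤ l / R ^ n := by gcongr
    exact Set.mem_iUnion.mpr ⟨n, hn, hle.trans_lt hz⟩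
  have hSempty : ⋂ k, S k = ∅ := by
    refine Set.eq_empty_of_forall_notMem fun z hz => ?_
    have hz' := fun k => Set.mem_iInter.mp hz k
    obtain ⟨n, hn, -⟩ := Set.mem_iUnion.mp (hz' 0)
    obtain ⟨C, hC⟩ := hR z hn
    obtain ⟨k, hk⟩ := exists_nat_ge C
    obtain ⟨m, -, hm⟩ := Set.mem_iUnion.mp (hz' k)
    have hm' : (k : ℝ) / R ^ m < ‖c m z‖ := hm
    have : C / R ^ m ≤ k / R ^ m := by gcongr
    linarith [hC m]
  have hSfin : volume (S 0) ≠ ⊤ := by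
    refine ne_top_of_le_ne_top (measure_ball_lt_top (x := (0 : ℂ)) (r := ρ)).ne (measure_mono ?_)
    exact Set.iUnion_subset fun n => Set.inter_subset_left
  have hlim := tendsto_measure_iInter_atTop (μ := volume)
    (fun k => (hSo k).measurableSet.nullMeasurableSet) hSanti ⟨0, hSfin⟩
  rw [hSempty, measure_empty] at hlim
  set L := Real.log (R / δ) with hL
  have hL0 : 0 < L := Real.log_pos ((one_lt_div hδ).mpr hδR)
  -- Chosen so that n L κ = n log (R / Q), which is exactly the loss allowed in passing from R to Q.
  set κ := Real.log (R / Q) / L with hκ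
  have hκ0 : 0 < κ := div_pos (Real.log_pos ((one_lt_div hQ).mpr hQR)) hL0
  have hvol : (0 : ENNReal) < ENNReal.ofReal (κ * (ρ / 2) ^ 2 / 4) := by
    rw [ENNReal.ofReal_pos]; positivity
  obtain ⟨k, hkv, hkM⟩ := ((hlim.eventually (gt_mem_nhds hvol)).and
    (Filter.eventually_ge_atTop (⌈max M 1⌉₊))).exists
  have hkM' : max M 1 ≤ k := Nat.ceil_le.mp hkM
  have hk1 : (1 : ℝ) ≤ k := (le_max_right _ _).trans hkM'
  have hkM2 : M ≤ k := (le_max_left _ _).trans hkM'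
  have hk0 : (0 : ℝ) < k := by linarith
  refine ⟨k, fun n z hz => ?_⟩
  rcases eq_or_ne (c n z) 0 with h0 | h0
  · rw [h0, norm_zero]; positivity
  obtain ⟨t, ht, htavg⟩ := exists_circleAverage_indicator_le (hSo k).measurableSet z
    (half_pos hρ) hκ0 hkv
  have hsub : ball z (ρ / 2) ⊆ ball 0 ρ := by
    refine ball_subset_ball' ?_
    have := mem_ball.mp hz
    linarith
  set a : ℂ := ((R ^ n / k : ℝ) : ℂ) with ha
  have ha0 : 0 < R ^ n / k := by positivity
  have han : ‖a‖ = R ^ n / k := by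
    rw [ha, Complex.norm_real, Real.norm_of_nonneg ha0.le]
  have hsph : ∀ w ∈ sphere z t, w ∈ ball (0 : ℂ) ρ := fun w hw =>
    hsub (sphere_subset_closedBall.trans (closedBall_subset_ball ht.2) hw)
  -- The normalized function (R^n / k) c_n has norm at most 1 off S k, and at most (R / δ)^n
  -- everywhere on the circle because k ≥ M.
  have key := log_norm_le_mul_circleAverage_indicator (f := fun w => a • c n w) (c := z)
    (Λ := n * L) ((by positivity : 0 < ρ / 2 / 2).trans ht.1) ht.2
    (((hc n).mono hsub).const_smul a)
    (smul_ne_zero (by rw [← norm_pos_iff, han]; exact ha0) h0)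
    (hSo k).measurableSet (by positivity) ?_ ?_
  · rw [norm_smul, han] at key
    have h1 : Real.log (R ^ n / k * ‖c n z‖) ≤ n * Real.log (R / Q) := by
      refine key.trans ((mul_le_mul_of_nonneg_left htavg (by positivity)).trans_eq ?_)
      rw [hκ]; field_simp
    rw [Real.log_le_iff_le_exp (by have := norm_pos_iff.mpr h0; positivity), mul_comm (n : ℝ),
      Real.exp_mul, Real.exp_log (by positivity), Real.rpow_natCast, div_pow] at h1
    have h2 : ‖c n z‖ = k / R ^ n * (R ^ n / k * ‖c n z‖) := by field_simp
    calc ‖c n z‖ = k / R ^ n * (R ^ n / k * ‖c n z‖) := h2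
      _ ≤ k / R ^ n * (R ^ n / Q ^ n) := by gcongr
      _ = k / Q ^ n := by field_simp
  · intro w hw hwS
    rw [norm_smul, han]
    have hle : ‖c n w‖ ≤ k / R ^ n := by
      by_contra! hlt
      exact hwS (Set.mem_iUnion.mpr ⟨n, hsph w hw, hlt⟩)
    calc R ^ n / k * ‖c n w‖ ≤ R ^ n / k * (k / R ^ n) := by gcongr
      _ = 1 := by field_simp
  · intro w hw
    rw [norm_smul, han, mul_comm (n : ℝ), Real.exp_mul, Real.exp_log (by positivity),
      Real.rpow_natCast, div_pow]
    calc R ^ n / k * ‖c n w‖ ≤ R ^ n / k * (k / δ ^ n) := by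
          gcongr
          exact (hM n w (hsph w hw)).trans (by gcongr)
      _ = R ^ n / δ ^ n := by field_simp

end Hartogs

/-! ### Hartogs' theorem and the double power series -/

section SeparatelyHolomorphic

open Metric

variable {E : Type*} [NormedAddCommGroup E] [NormedSpace ℂ E]

/-- By Baire's theorem, a separately holomorphic function is bounded on some product of discs. -/
theorem exists_ball_bound_of_separately_holomorphic {F : ℂ → ℂ → E} {r s t : ℝ} (ht : 0 < t)
    (hsr : s < r) (htr : t ≤ r)
    (h₁ : ∀ v ∈ ball 0 r, DifferentiableOn ℂ (fun z => F z v) (ball 0 r))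
    (h₂ : ∀ z ∈ ball 0 r, DifferentiableOn ℂ (F z) (ball 0 r)) :
    ∃ v₀ : ℂ, ∃ δ > 0, ball v₀ δ ⊆ ball 0 t ∧ ∃ M : ℝ, ∀ z ∈ ball 0 s, ∀ v ∈ ball v₀ δ,
      ‖F z v‖ ≤ M := by
  -- S k consists of the v with ‖F z v‖ ≤ k for all z in the closed disc, together with everything
  -- outside ball 0 t, so that these closed sets cover the whole plane.
  set S : ℕ → Set ℂ := fun k => ⋂ z ∈ closedBall (0 : ℂ) s,
    (ball 0 t ∩ F z ⁻¹' {x | (k : ℝ) < ‖x‖})ᶜ with hS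
  have hSc : ∀ k, IsClosed (S k) := fun k => isClosed_biInter fun z hz =>
    (((h₂ z (closedBall_subset_ball hsr hz)).continuousOn.mono
      (ball_subset_ball htr)).isOpen_inter_preimage isOpen_ball
        (isOpen_lt continuous_const continuous_norm)).isClosed_compl
  have hSU : ⋃ k, S k = Set.univ := by
    refine Set.eq_univ_of_forall fun v => Set.mem_iUnion.mpr ?_
    by_cases hv : v ∈ ball (0 : ℂ) t
    · obtain ⟨C, hC⟩ := (isCompact_closedBall (0 : ℂ) s).exists_bound_of_continuousOn
        ((h₁ v (ball_subset_ball htr hv)).continuousOn.mono (closedBall_subset_ball hsr))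
      obtain ⟨k, hk⟩ := exists_nat_ge C
      refine ⟨k, Set.mem_iInter₂.mpr fun z hz h => ?_⟩
      have : (k : ℝ) < ‖F z v‖ := h.2
      linarith [hC z hz]
    · exact ⟨0, Set.mem_iInter₂.mpr fun z hz h => hv h.1⟩
  obtain ⟨v₀, hv₀, hv₀'⟩ := (dense_iUnion_interior_of_closed hSc hSU).inter_open_nonempty
    (ball 0 t) isOpen_ball ⟨0, mem_ball_self ht⟩
  obtain ⟨k, hk⟩ := Set.mem_iUnion.mp hv₀'
  obtain ⟨δ, hδ, hsub⟩ := Metric.isOpen_iff.mp (isOpen_ball.inter isOpen_interior) v₀ ⟨hv₀, hk⟩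
  refine ⟨v₀, δ, hδ, fun v hv => (hsub hv).1, k, fun z hz v hv => ?_⟩
  have := Set.mem_iInter₂.mp (interior_subset (hsub hv).2) z (ball_subset_closedBall hz)
  by_contra! hlt
  exact this ⟨(hsub hv).1, hlt⟩

variable [CompleteSpace E]

/-- **Hartogs' theorem**, in the following form: a separately holomorphic function is bounded near
the origin. -/
theorem exists_bound_near_zero_of_separately_holomorphic {F : ℂ → ℂ → E} {r : ℝ} (hr : 0 < r)
    (h₁ : ∀ v ∈ ball 0 r, DifferentiableOn ℂ (fun z => F z v) (ball 0 r))
    (h₂ : ∀ z ∈ ball 0 r, DifferentiableOn ℂ (F z) (ball 0 r)) :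
    ∃ ε, 0 < ε ∧ ε ≤ r ∧ ∃ M : ℝ, ∀ z ∈ ball 0 ε, ∀ v ∈ ball 0 ε, ‖F z v‖ ≤ M := by
  -- With ‖v₀‖ < r/4, the disc of radius 3r/4 about v₀ stays inside ball 0 r. Cauchy's estimate on
  -- the circle of radius r/2 then gives the pointwise bounds.
  obtain ⟨v₀, δ, hδ, hsub, M, hM⟩ := exists_ball_bound_of_separately_holomorphic
    (s := r / 2) (t := r / 4) (by positivity) (by linarith) (by linarith) h₁ h₂
  have hv₀ : ‖v₀‖ < r / 4 := by simpa using hsub (mem_ball_self hδ)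
  have htr : ∀ u ∈ ball (0 : ℂ) (3 * r / 4), v₀ + u ∈ ball (0 : ℂ) r := fun u hu => by
    rw [mem_ball_zero_iff] at hu ⊢
    linarith [norm_add_le v₀ u]
  have hsub' : ball (0 : ℂ) (r / 2) ⊆ ball 0 r := ball_subset_ball (by linarith)
  set G : ℂ → ℂ → E := fun z u => F z (v₀ + u) with hG
  have hG₂ : ∀ z ∈ ball (0 : ℂ) (r / 2), DifferentiableOn ℂ (G z) (ball 0 (3 * r / 4)) :=
    fun z hz => (h₂ z (hsub' hz)).comp (by fun_prop) htr
  set δ' := min δ (3 * r / 4) with hδ'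
  have hδ'0 : 0 < δ' := lt_min hδ (by positivity)
  have hδsub : ball (0 : ℂ) δ' ⊆ ball 0 (3 * r / 4) := ball_subset_ball (min_le_right _ _)
  have hGM : ∀ z ∈ ball (0 : ℂ) (r / 2), ∀ u ∈ ball (0 : ℂ) δ', ‖G z u‖ ≤ M := by
    intro z hz u hu
    refine hM z hz _ ?_
    have := (mem_ball_zero_iff.mp hu).trans_le (min_le_left _ _)
    simpa [mem_ball, dist_eq_norm] using this
  obtain ⟨C, hC⟩ := exists_uniform_bound_of_pointwise_bound
    (c := fun n z => taylorCoeff (G z) n) (ρ := r / 2) (M := M) (δ := δ') (Q := 3 * r / 8)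
    (R := r / 2) (by positivity) hδ'0 (by positivity) (by linarith)
    (fun n => differentiableOn_taylorCoeff isOpen_ball hδ'0
      (fun u hu => (h₁ _ (htr u (hδsub hu))).mono hsub')
      (fun z hz => (hG₂ z hz).mono hδsub) hGM n)
    (fun n z hz => norm_taylorCoeff_le hδ'0 ((hG₂ z hz).mono hδsub) (hGM z hz) n)
    (fun z hz => by
      have hcl : closedBall (0 : ℂ) (r / 2) ⊆ ball 0 (3 * r / 4) :=
        closedBall_subset_ball (by linarith)
      obtain ⟨C, hC⟩ := (isCompact_closedBall (0 : ℂ) (r / 2)).exists_bound_of_continuousOn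
        ((hG₂ z hz).continuousOn.mono hcl)
      refine ⟨C, fun n => norm_taylorCoeff_le_of_sphere (by positivity) ?_
        (fun u hu => hC u (sphere_subset_closedBall hu)) n⟩
      apply DifferentiableOn.diffContOnCl
      rw [closure_ball _ (by positivity)]
      exact (hG₂ z hz).mono hcl)
  -- For ‖v‖ < r/16, ‖v - v₀‖ ≤ 5r/16 < 3r/8, so the Taylor series about v₀ is dominated by a
  -- geometric series of ratio 5/6.
  refine ⟨r / 16, by positivity, by linarith, C * (1 - 5 / 6)⁻¹, fun z hz v hv => ?_⟩
  rw [mem_ball_zero_iff] at hv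
  have hz2 : z ∈ ball (0 : ℂ) (r / 2 / 2) := ball_subset_ball (by linarith) hz
  have hu : ‖v - v₀‖ ≤ 5 * r / 16 := by linarith [norm_sub_le v v₀]
  have hs := hasSum_taylorCoeff (hG₂ z (ball_subset_ball (by linarith) hz))
    (z := v - v₀) (by rw [mem_ball_zero_iff]; linarith)
  have hGv : G z (v - v₀) = F z v := by simp [hG]
  rw [hGv] at hs
  rw [← hs.tsum_eq]
  refine tsum_of_norm_bounded
    ((hasSum_geometric_of_lt_one (by norm_num) (by norm_num)).mul_left C) fun n => ?_
  have hC0 : 0 ≤ C := by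
    have := (norm_nonneg _).trans (hC 0 z hz2)
    simpa using this
  rw [norm_smul, norm_pow]
  calc ‖v - v₀‖ ^ n * ‖taylorCoeff (G z) n‖ ≤ (5 * r / 16) ^ n * (C / (3 * r / 8) ^ n) := by
        gcongr
        exact hC n z hz2
    _ = C * ((5 * r / 16) / (3 * r / 8)) ^ n := by
        rw [div_pow (5 * r / 16) (3 * r / 8), ← mul_div_assoc, ← mul_div_assoc, mul_comm]
    _ = C * (5 / 6) ^ n := by congr 2; field_simp; norm_num

/-- A separately holomorphic function has a double power series expansion at the origin, with
exponential bounds for the coefficients. -/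
theorem exists_double_power_series_of_separately_holomorphic {F : ℂ → ℂ → E} {r : ℝ} (hr : 0 < r)
    (h₁ : ∀ v ∈ ball 0 r, DifferentiableOn ℂ (fun z => F z v) (ball 0 r))
    (h₂ : ∀ z ∈ ball 0 r, DifferentiableOn ℂ (F z) (ball 0 r)) :
    ∃ ε, 0 < ε ∧ ε ≤ r ∧ ∃ (M : ℝ) (a : ℕ × ℕ → E), (∀ p, ‖a p‖ ≤ M / ε ^ (p.1 + p.2)) ∧
      ∀ z ∈ ball 0 ε, ∀ v ∈ ball 0 ε, HasSum (fun p => (z ^ p.1 * v ^ p.2) • a p) (F z v) := by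
  obtain ⟨ε, hε, hεr, M, hM⟩ := exists_bound_near_zero_of_separately_holomorphic hr h₁ h₂
  have hsub := ball_subset_ball (x := (0 : ℂ)) hεr
  have h₁' : ∀ v ∈ ball (0 : ℂ) ε, DifferentiableOn ℂ (fun z => F z v) (ball 0 ε) :=
    fun v hv => (h₁ v (hsub hv)).mono hsub
  have h₂' : ∀ z ∈ ball (0 : ℂ) ε, DifferentiableOn ℂ (F z) (ball 0 ε) :=
    fun z hz => (h₂ z (hsub hz)).mono hsub
  have hd : ∀ n, DifferentiableOn ℂ (fun z => taylorCoeff (F z) n) (ball 0 ε) :=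
    differentiableOn_taylorCoeff isOpen_ball hε h₁' h₂' hM
  have ha : ∀ p : ℕ × ℕ, ‖taylorCoeff (fun z => taylorCoeff (F z) p.2) p.1‖
      ≤ M / ε ^ (p.1 + p.2) := fun p => by
    refine (norm_taylorCoeff_le hε (hd p.2)
      (fun z hz => norm_taylorCoeff_le hε (h₂' z hz) (hM z hz) p.2) p.1).trans_eq ?_
    rw [div_div, pow_add, mul_comm]
  refine ⟨ε, hε, hεr, M, fun p => taylorCoeff (fun z => taylorCoeff (F z) p.2) p.1, ha,
    fun z hz v hv => ?_⟩
  -- Expansion in v first and then in z; absolute convergence identifies the iterated sum with the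
  -- double sum.
  rw [← (Equiv.prodComm ℕ ℕ).hasSum_iff]
  have hfib : ∀ n, HasSum
      (fun m => (z ^ m * v ^ n) • taylorCoeff (fun z => taylorCoeff (F z) n) m)
      (v ^ n • taylorCoeff (F z) n) := fun n => by
    simpa only [smul_smul, mul_comm] using (hasSum_taylorCoeff (hd n) hz).const_smul (v ^ n)
  have hsum : Summable fun p : ℕ × ℕ =>
      (z ^ p.2 * v ^ p.1) • taylorCoeff (fun z => taylorCoeff (F z) p.1) p.2 := by
    rw [mem_ball_zero_iff] at hz hv
    have hg : Summable fun p : ℕ × ℕ => M * ((‖v‖ / ε) ^ p.1 * (‖z‖ / ε) ^ p.2) :=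
      ((summable_geometric_of_lt_one (by positivity) ((div_lt_one hε).mpr hv)).mul_of_nonneg
        (summable_geometric_of_lt_one (by positivity) ((div_lt_one hε).mpr hz))
        (fun _ => by positivity) (fun _ => by positivity)).mul_left M
    refine hg.of_norm_bounded fun p => ?_
    rw [norm_smul, norm_mul, norm_pow, norm_pow]
    calc _ ≤ ‖z‖ ^ p.2 * ‖v‖ ^ p.1 * (M / ε ^ (p.2 + p.1)) := by gcongr; exact ha (p.2, p.1)
      _ = _ := by rw [div_pow, div_pow, pow_add]; field_simp
  have := hsum.hasSum.prod_fiberwise hfib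
  rw [(hasSum_taylorCoeff (h₂' z hz) hv).unique this]
  exact hsum.hasSum

end SeparatelyHolomorphic

/-! ### Krein spaces from self-adjoint factorizations -/

section Krein

/-- The pulled-back form makes e a surjective isometry, so completeness passes from W to V. -/
theorem isHilbertInnerProduct_of_linearEquiv {V W : Type*} [AddCommGroup V] [Module ℂ V]
    [NormedAddCommGroup W] [InnerProductSpace ℂ W] [CompleteSpace W] (e : V ≃ₗ[ℂ] W) :
    IsHilbertInnerProduct fun x y : V => inner ℂ (e y) (e x) := by
  let core : InnerProductSpace.Core ℂ V :=
    { inner := fun x y => inner ℂ (e x) (e y)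
      conj_inner_symm := fun x y => inner_conj_symm _ _
      re_inner_nonneg := fun x => inner_self_nonneg
      add_left := fun x y z => by rw [map_add, inner_add_left]
      smul_left := fun x y c => by rw [map_smul, inner_smul_left]
      definite := fun x hx => e.map_eq_zero_iff.mp (inner_self_eq_zero.mp hx) }
  refine ⟨core, fun x y => rfl, ?_⟩
  let : NormedAddCommGroup V := core.toNormedAddCommGroup
  have hn : ∀ x : V, ‖x‖ = ‖e x‖ := fun x => (norm_eq_sqrt_re_inner (𝕜 := ℂ) (e x)).symm
  have hi : Isometry e := Isometry.of_dist_eq fun x y => by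
    rw [dist_eq_norm, dist_eq_norm, hn (x - y), map_sub]
  exact hi.isUniformInducing.completeSpace_congr e.surjective |>.mpr inferInstance

variable {H : Type*} [NormedAddCommGroup H] [InnerProductSpace ℂ H]

/-- A reproducing kernel Krein space is obtained by transport from the Krein space
`W₁ ⊕ W₂`, with the form of `W₂` changed in sign, along an injective map into the functions. -/
theorem exists_isReproducingKernelKreinSpace_of_injective {X : Type*} (K : X → X → H →L[ℂ] H)
    {W₁ W₂ : Type*} [NormedAddCommGroup W₁] [InnerProductSpace ℂ W₁] [CompleteSpace W₁]
    [NormedAddCommGroup W₂] [InnerProductSpace ℂ W₂] [CompleteSpace W₂]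
    (T : W₁ × W₂ →ₗ[ℂ] X → H) (hT : Function.Injective T) (k₁ : X → H → W₁) (k₂ : X → H → W₂)
    -- The minus sign cancels the sign of the form on W₂, whence the plus sign in `hrep`.
    (hk : ∀ y h, T (k₁ y h, -k₂ y h) = fun x => K x y h)
    (hrep : ∀ w x h, inner ℂ h (T w x) = inner ℂ (k₁ x h) w.1 + inner ℂ (k₂ x h) w.2) :
    ∃ (R : Submodule ℂ (X → H)) (B : R →ₗ[ℂ] R →ₗ⋆[ℂ] ℂ),
      IsReproducingKernelKreinSpace K R B := by
  let e : LinearMap.range T ≃ₗ[ℂ] W₁ × W₂ := (LinearEquiv.ofInjective T hT).symm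
  have hTe : ∀ f, T (e f) = f := fun f =>
    congrArg Subtype.val ((LinearEquiv.ofInjective T hT).apply_symm_apply f)
  let B : LinearMap.range T →ₗ[ℂ] LinearMap.range T →ₗ⋆[ℂ] ℂ :=
    LinearMap.mk₂'ₛₗ (RingHom.id ℂ) (starRingEnd ℂ)
      (fun f g => inner ℂ (e g).1 (e f).1 - inner ℂ (e g).2 (e f).2)
      (fun f f' g => by simp only [map_add, Prod.fst_add, Prod.snd_add, inner_add_right]; ring)
      (fun c f g => by
        simp only [map_smul, Prod.smul_fst, Prod.smul_snd, inner_smul_right, RingHom.id_apply,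
          smul_eq_mul]
        ring)
      (fun f g g' => by simp only [map_add, Prod.fst_add, Prod.snd_add, inner_add_left]; ring)
      (fun c f g => by
        simp only [map_smul, Prod.smul_fst, Prod.smul_snd, inner_smul_left, smul_eq_mul]
        ring)
  have hB : ∀ f g, B f g = inner ℂ (e g).1 (e f).1 - inner ℂ (e g).2 (e f).2 := fun _ _ => rfl
  let P : Submodule ℂ (LinearMap.range T) := LinearMap.ker (LinearMap.snd ℂ W₁ W₂ ∘ₗ e.toLinearMap)
  let N : Submodule ℂ (LinearMap.range T) := LinearMap.ker (LinearMap.fst ℂ W₁ W₂ ∘ₗ e.toLinearMap)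
  have hP : ∀ f : P, (e f).2 = 0 := fun f => f.2
  have hN : ∀ f : N, (e f).1 = 0 := fun f => f.2
  let φP : P →ₗ[ℂ] W₁ := LinearMap.fst ℂ W₁ W₂ ∘ₗ e.toLinearMap ∘ₗ P.subtype
  have heP : Function.Bijective φP := by
    refine ⟨fun f g hfg => Subtype.ext (e.injective (Prod.ext hfg ((hP f).trans (hP g).symm))),
      fun w => ⟨⟨e.symm (w, 0), ?_⟩, ?_⟩⟩
    · simp [P]
    · simp [φP]
  let φN : N →ₗ[ℂ] W₂ := LinearMap.snd ℂ W₁ W₂ ∘ₗ e.toLinearMap ∘ₗ N.subtype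
  have heN : Function.Bijective φN := by
    refine ⟨fun f g hfg => Subtype.ext (e.injective (Prod.ext ((hN f).trans (hN g).symm) hfg)),
      fun w => ⟨⟨e.symm (0, w), ?_⟩, ?_⟩⟩
    · simp [N]
    · simp [φN]
  have hk' : ∀ y h, (fun x => K x y h) ∈ LinearMap.range T := fun y h => ⟨_, hk y h⟩
  refine ⟨LinearMap.range T, B, ⟨fun f g => ?_, P, N, ?_, fun f hf g hg => ?_, ?_, ?_⟩, hk', ?_⟩
  · rw [hB, hB, map_sub, inner_conj_symm, inner_conj_symm]
  · refine ⟨Submodule.disjoint_def.mpr fun f hf hg => ?_, codisjoint_iff.mpr ?_⟩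
    · exact e.map_eq_zero_iff.mp (Prod.ext hg hf)
    · refine (Submodule.eq_top_iff').mpr fun f => Submodule.mem_sup.mpr
        ⟨e.symm ((e f).1, 0), by simp [P], e.symm (0, (e f).2), by simp [N], ?_⟩
      rw [← map_add, Prod.mk_add_mk, add_zero, zero_add, Prod.mk.eta, e.symm_apply_apply]
  · rw [hB, hN ⟨g, hg⟩, hP ⟨f, hf⟩, inner_zero_left, inner_zero_right, sub_zero]
  · have h := isHilbertInnerProduct_of_linearEquiv (V := P) (W := W₁)
      (LinearEquiv.ofBijective φP heP)
    convert h using 3 with f g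
    rw [hB, hP f, inner_zero_right, sub_zero]
    rfl
  · have h := isHilbertInnerProduct_of_linearEquiv (V := N) (W := W₂)
      (LinearEquiv.ofBijective φN heN)
    convert h using 3 with f g
    rw [hB, hN f, inner_zero_right, zero_sub, neg_neg]
    rfl
  · intro f x h
    have : e ⟨fun z => K z x h, hk' x h⟩ = (k₁ x h, -k₂ x h) :=
      hT ((hTe _).trans (hk x h).symm)
    rw [hB, this, inner_neg_left, sub_neg_eq_add, ← hrep, hTe]

variable [CompleteSpace H]

open ContinuousLinearMap in
/-- A kernel which factors as `K x y = (E x)* A (E y)`, with `A` self-adjoint and the ranges of the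
`E x` together total, is the reproducing kernel of a Krein space. -/
theorem exists_isReproducingKernelKreinSpace_of_factorization {X G : Type*}
    [NormedAddCommGroup G] [InnerProductSpace ℂ G] [CompleteSpace G] (K : X → X → H →L[ℂ] H)
    {A : G →L[ℂ] G} (hA : IsSelfAdjoint A) (E : X → H →L[ℂ] G)
    (hE : ∀ g, (∀ x, adjoint (E x) g = 0) → g = 0)
    (hK : ∀ x y h, K x y h = adjoint (E x) (A (E y h))) :
    ∃ (R : Submodule ℂ (X → H)) (B : R →ₗ[ℂ] R →ₗ⋆[ℂ] ℂ),
      IsReproducingKernelKreinSpace K R B := by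
  -- S₁ and S₂ are the square roots of the positive and negative parts of A.
  obtain ⟨S₁, S₂, hS₁, hS₂, h12, h21, hS⟩ : ∃ S₁ S₂ : G →L[ℂ] G, IsSelfAdjoint S₁ ∧
      IsSelfAdjoint S₂ ∧ S₁ * S₂ = 0 ∧ S₂ * S₁ = 0 ∧ S₁ * S₁ - S₂ * S₂ = A := by
    have hc₁ : Continuous fun x : ℝ => √(max x 0) := by fun_prop
    have hc₂ : Continuous fun x : ℝ => √(max (-x) 0) := by fun_prop
    have hc₁₁ : Continuous fun x : ℝ => √(max x 0) * √(max x 0) := by fun_prop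
    have hc₂₂ : Continuous fun x : ℝ => √(max (-x) 0) * √(max (-x) 0) := by fun_prop
    refine ⟨cfc (fun x : ℝ => √(max x 0)) A, cfc (fun x : ℝ => √(max (-x) 0)) A,
      cfc_predicate _ _, cfc_predicate _ _, ?_, ?_, ?_⟩
    · rw [← cfc_mul _ _ A hc₁.continuousOn hc₂.continuousOn, ← cfc_const_zero ℝ A]
      refine cfc_congr fun x _ => ?_
      rcases le_total x 0 with hx | hx <;> simp [hx]
    · rw [← cfc_mul _ _ A hc₂.continuousOn hc₁.continuousOn, ← cfc_const_zero ℝ A]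
      refine cfc_congr fun x _ => ?_
      rcases le_total x 0 with hx | hx <;> simp [hx]
    · rw [← cfc_mul _ _ A hc₁.continuousOn hc₁.continuousOn,
        ← cfc_mul _ _ A hc₂.continuousOn hc₂.continuousOn,
        ← cfc_sub _ _ A hc₁₁.continuousOn hc₂₂.continuousOn]
      conv_rhs => rw [← cfc_id ℝ A]
      refine cfc_congr fun x _ => ?_
      rcases le_total x 0 with hx | hx <;> simp [hx]
  have hsa : ∀ {S : G →L[ℂ] G}, IsSelfAdjoint S → ∀ x y, inner ℂ (S x) y = inner ℂ x (S y) :=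
    fun hS x y => hS.isSymmetric x y
  have hran : ∀ {S : G →L[ℂ] G}, IsSelfAdjoint S → ∀ x, S x ∈ (LinearMap.ker S.toLinearMap)ᗮ := by
    intro S hS x
    rw [Submodule.mem_orthogonal]
    intro u hu
    have hu' : S u = 0 := hu
    rw [← hsa hS, hu', inner_zero_left]
  have hinj : ∀ {S : G →L[ℂ] G}, IsSelfAdjoint S → ∀ w ∈ (LinearMap.ker S.toLinearMap)ᗮ,
      S (S w) = 0 → w = 0 := by
    intro S hS w hw hSw
    have h1 : S w = 0 := by
      rw [← inner_self_eq_zero (𝕜 := ℂ), hsa hS, hSw, inner_zero_right]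
    exact inner_self_eq_zero.mp (Submodule.mem_orthogonal _ _ |>.mp hw w h1)
  have h12' : ∀ x, S₁ (S₂ x) = 0 := fun x => DFunLike.congr_fun h12 x
  have h21' : ∀ x, S₂ (S₁ x) = 0 := fun x => DFunLike.congr_fun h21 x
  have hS' : ∀ x, S₁ (S₁ x) - S₂ (S₂ x) = A x := fun x => DFunLike.congr_fun hS x
  -- Being closed, these complements are complete; they contain the ranges of S₁ and S₂, and S₁, S₂
  -- are injective on them.
  let W₁ := (LinearMap.ker S₁.toLinearMap)ᗮ
  let W₂ := (LinearMap.ker S₂.toLinearMap)ᗮ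
  let L : W₁ × W₂ →ₗ[ℂ] G :=
    (S₁.toLinearMap ∘ₗ W₁.subtype).coprod (S₂.toLinearMap ∘ₗ W₂.subtype)
  have hL : ∀ w, L w = S₁ w.1 + S₂ w.2 := fun _ => rfl
  let T : W₁ × W₂ →ₗ[ℂ] X → H := LinearMap.pi fun x => (adjoint (E x)).toLinearMap ∘ₗ L
  have hT : ∀ w x, T w x = adjoint (E x) (S₁ w.1 + S₂ w.2) := fun _ _ => rfl
  refine exists_isReproducingKernelKreinSpace_of_injective K T ?_
    (fun x h => ⟨S₁ (E x h), hran hS₁ _⟩) (fun x h => ⟨S₂ (E x h), hran hS₂ _⟩) ?_ ?_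
  · refine (injective_iff_map_eq_zero T).mpr fun w hw => ?_
    have h0 : S₁ w.1 + S₂ w.2 = 0 := hE _ fun x => by rw [← hT, hw, Pi.zero_apply]
    -- Applying S₁ to S₁w₁ + S₂w₂ = 0 leaves S₁²w₁ = 0, and likewise for S₂.
    refine Prod.ext (Subtype.ext (hinj hS₁ _ w.1.2 ?_)) (Subtype.ext (hinj hS₂ _ w.2.2 ?_))
    · simpa [h12'] using congrArg S₁ h0
    · simpa [h21'] using congrArg S₂ h0
  · intro y h
    funext x
    rw [hT, hK, ← hS']
    simp [sub_eq_add_neg]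
  · intro w x h
    rw [hT, adjoint_inner_right, inner_add_right, ← hsa hS₁, ← hsa hS₂]
    rfl

end Krein

/-! ### Operator matrices on ℓ²(H) and evaluation of power series -/

section PowerSeries

open ContinuousLinearMap

variable {H : Type*} [NormedAddCommGroup H] [InnerProductSpace ℂ H]

/-- The space of square summable sequences in `H`. -/
def SquareSummable (H : Type*) [NormedAddCommGroup H] : Type _ := lp (fun _ : ℕ => H) 2

noncomputable instance : NormedAddCommGroup (SquareSummable H) :=
  inferInstanceAs (NormedAddCommGroup (lp (fun _ : ℕ => H) 2))

noncomputable instance : InnerProductSpace ℂ (SquareSummable H) :=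
  inferInstanceAs (InnerProductSpace ℂ (lp (fun _ : ℕ => H) 2))

instance [CompleteSpace H] : CompleteSpace (SquareSummable H) :=
  inferInstanceAs (CompleteSpace (lp (fun _ : ℕ => H) 2))

/-- The inclusion of `H` as the `n`-th coordinate space. -/
noncomputable def coordIncl (H : Type*) [NormedAddCommGroup H] [InnerProductSpace ℂ H] (n : ℕ) :
    H →L[ℂ] SquareSummable H :=
  lp.singleContinuousLinearMap ℂ (fun _ : ℕ => H) 2 n

/-- The projection to the `n`-th coordinate. -/
noncomputable def coordProj (H : Type*) [NormedAddCommGroup H] [InnerProductSpace ℂ H] (n : ℕ) :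
    SquareSummable H →L[ℂ] H :=
  lp.evalCLM ℂ (fun _ : ℕ => H) 2 n

theorem norm_coordIncl_le (n : ℕ) : ‖coordIncl H n‖ ≤ 1 :=
  opNorm_le_bound _ zero_le_one fun x => by
    rw [one_mul]
    exact (lp.norm_single (E := fun _ : ℕ => H) (p := 2) (by norm_num) n x).le

theorem norm_coordProj_le (n : ℕ) : ‖coordProj H n‖ ≤ 1 :=
  opNorm_le_bound _ zero_le_one fun x => by
    rw [one_mul]
    exact lp.norm_apply_le_norm (E := fun _ : ℕ => H) (p := 2) (by norm_num) x n

theorem coordProj_comp_coordIncl (m n : ℕ) :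
    coordProj H m ∘L coordIncl H n = if m = n then ContinuousLinearMap.id ℂ H else 0 := by
  ext x
  split_ifs with h
  · subst h
    exact lp.single_apply_self (E := fun _ : ℕ => H) 2 m x
  · exact lp.single_apply_ne (E := fun _ : ℕ => H) 2 n x h

theorem SquareSummable.ext_coordProj {g g' : SquareSummable H}
    (h : ∀ n, coordProj H n g = coordProj H n g') : g = g' :=
  lp.ext (E := fun _ : ℕ => H) (p := 2) (funext h)

theorem inner_coordIncl (n : ℕ) (x : H) (y : SquareSummable H) :
    inner ℂ (coordIncl H n x) y = inner ℂ x (coordProj H n y) :=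
  lp.inner_single_left (𝕜 := ℂ) (G := fun _ : ℕ => H) n x y

variable [CompleteSpace H]

theorem adjoint_coordProj (n : ℕ) : adjoint (coordProj H n) = coordIncl H n :=
  ((eq_adjoint_iff (coordIncl H n) (coordProj H n)).mpr (inner_coordIncl n)).symm

/-- Evaluation at `z` of the power series with given square summable coefficients. -/
noncomputable def evalPowerSeries (H : Type*) [NormedAddCommGroup H] [InnerProductSpace ℂ H]
    (z : ℂ) : SquareSummable H →L[ℂ] H :=
  -- Convergence is in operator norm; only ‖z‖ < 1 matters, and a divergent sum has the default
  -- value 0.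
  ∑' n, z ^ n • coordProj H n

theorem hasSum_evalPowerSeries {z : ℂ} (hz : ‖z‖ < 1) :
    HasSum (fun n => z ^ n • coordProj H n) (evalPowerSeries H z) := by
  have hg := summable_geometric_of_lt_one (norm_nonneg z) hz
  have hle : ∀ n, ‖z ^ n • coordProj H n‖ ≤ ‖z‖ ^ n := fun n => by
    rw [norm_smul, norm_pow]
    exact mul_le_of_le_one_right (by positivity) (norm_coordProj_le n)
  have hs : Summable fun n => z ^ n • coordProj H n := hg.of_norm_bounded hle
  exact hs.hasSum

theorem evalPowerSeries_comp_coordIncl {z : ℂ} (hz : ‖z‖ < 1) (n : ℕ) :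
    evalPowerSeries H z ∘L coordIncl H n = z ^ n • ContinuousLinearMap.id ℂ H := by
  have h := (hasSum_evalPowerSeries (H := H) hz).mapL
    ((compL ℂ H (SquareSummable H) H).flip (coordIncl H n))
  refine h.unique ?_
  convert hasSum_single n fun m hm => ?_ using 1
  · simp [coordProj_comp_coordIncl]
  · simp [coordProj_comp_coordIncl, hm]

/-- Adjoint of `evalPowerSeries_comp_coordIncl`: E(z)* h is the sequence (conj z ^ n • h). -/
theorem coordProj_comp_adjoint_evalPowerSeries {z : ℂ} (hz : ‖z‖ < 1) (n : ℕ) :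
    coordProj H n ∘L adjoint (evalPowerSeries H z) = conj z ^ n • ContinuousLinearMap.id ℂ H := by
  have h := congrArg adjoint (evalPowerSeries_comp_coordIncl (H := H) hz n)
  rw [adjoint_comp, ← adjoint_coordProj, adjoint_adjoint] at h
  rw [h, LinearIsometryEquiv.map_smulₛₗ, map_pow]
  congr 1
  exact ((eq_adjoint_iff _ _).mpr fun x y => rfl).symm

/-- Uniqueness of power series coefficients. This is the totality of the ranges of the E(z)*, which
makes the model map injective. -/
theorem eq_zero_of_evalPowerSeries_eq_zero {g : SquareSummable H} {ε : ℝ} (hε : 0 < ε)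
    (h : ∀ z ∈ Metric.ball (0 : ℂ) ε, evalPowerSeries H z g = 0) : g = 0 := by
  let p : FormalMultilinearSeries ℂ ℂ H := fun n => ContinuousMultilinearMap.mkPiRing ℂ (Fin n) (coordProj H n g)
  have hp : HasFPowerSeriesAt (fun _ : ℂ => (0 : H)) p 0 := by
    rw [hasFPowerSeriesAt_iff]
    filter_upwards [Metric.ball_mem_nhds (0 : ℂ) hε, Metric.ball_mem_nhds (0 : ℂ) zero_lt_one]
      with z hz hz1
    have := (hasSum_evalPowerSeries (H := H) (mem_ball_zero_iff.mp hz1)).mapL (apply ℂ H g)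
    convert this using 1
    · funext n
      simp only [p, FormalMultilinearSeries.coeff, ContinuousMultilinearMap.mkPiRing_apply,
        Pi.one_apply, Finset.prod_const_one, one_smul]
      rfl
    · exact (h z hz).symm
  have h0 := hp.eq_zero
  refine SquareSummable.ext_coordProj fun n => ?_
  have := congrArg (fun q : FormalMultilinearSeries ℂ ℂ H => q.coeff n) h0
  simpa [p, FormalMultilinearSeries.coeff] using this

/-- The operator matrix with entries `a (m, n)`. -/
noncomputable def operatorMatrix (a : ℕ × ℕ → H →L[ℂ] H) :
    SquareSummable H →L[ℂ] SquareSummable H :=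
  ∑' p : ℕ × ℕ, coordIncl H p.1 ∘L a p ∘L coordProj H p.2

theorem hasSum_operatorMatrix {a : ℕ × ℕ → H →L[ℂ] H} (ha : Summable fun p => ‖a p‖) :
    HasSum (fun p : ℕ × ℕ => coordIncl H p.1 ∘L a p ∘L coordProj H p.2) (operatorMatrix a) := by
  refine Summable.hasSum (ha.of_norm_bounded fun p => ?_)
  calc _ ≤ ‖coordIncl H p.1‖ * (‖a p‖ * ‖coordProj H p.2‖) :=
        (opNorm_comp_le _ _).trans (by gcongr; exact opNorm_comp_le _ _)
    _ ≤ 1 * (‖a p‖ * 1) := by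
        gcongr
        · exact norm_coordIncl_le _
        · exact norm_coordProj_le _
    _ = ‖a p‖ := by ring

/-- E(z) and E(w)* act on the (m, n) entry of the matrix as the scalars z^m and conj w^n, so a
double power series factors through its coefficient matrix. -/
theorem hasSum_evalPowerSeries_operatorMatrix {a : ℕ × ℕ → H →L[ℂ] H}
    (ha : Summable fun p => ‖a p‖) {z w : ℂ} (hz : ‖z‖ < 1) (hw : ‖w‖ < 1) :
    HasSum (fun p : ℕ × ℕ => (z ^ p.1 * conj w ^ p.2) • a p)
      (evalPowerSeries H z ∘L operatorMatrix a ∘L adjoint (evalPowerSeries H w)) := by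
  have h := ((hasSum_operatorMatrix ha).mapL
    ((compL ℂ H (SquareSummable H) (SquareSummable H)).flip
      (adjoint (evalPowerSeries H w)))).mapL
        (compL ℂ H (SquareSummable H) H (evalPowerSeries H z))
  have hE : evalPowerSeries H z ∘L operatorMatrix a ∘L adjoint (evalPowerSeries H w) =
      compL ℂ H (SquareSummable H) H (evalPowerSeries H z)
        ((compL ℂ H (SquareSummable H) (SquareSummable H)).flip
          (adjoint (evalPowerSeries H w)) (operatorMatrix a)) := rfl
  rw [hE]
  convert h using 1
  funext p
  have h1 := evalPowerSeries_comp_coordIncl (H := H) hz p.1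
  have h2 := coordProj_comp_adjoint_evalPowerSeries (H := H) hw p.2
  ext x
  have h1' := fun y => DFunLike.congr_fun h1 y
  have h2' := DFunLike.congr_fun h2 x
  simp only [comp_apply, smul_apply, ContinuousLinearMap.id_apply] at h1' h2'
  simp only [compL_apply, flip_apply, comp_apply, smul_apply, h1', h2', map_smul, smul_smul,
    mul_comm]

end PowerSeries

/-! ### Factorization of the kernel and conclusion -/

open ContinuousLinearMap in
theorem theorem9p1 {H : Type*} [NormedAddCommGroup H] [InnerProductSpace ℂ H] [CompleteSpace H]
    (r : ℝ) (hr : 0 < r) (K : ℂ → ℂ → H →L[ℂ] H)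
    (hHerm : IsHermitianKernelOn K (Metric.ball 0 r))
    (hHol : IsHolomorphicKernelOn K (Metric.ball 0 r)) :
    ∃ r' : ℝ, 0 < r' ∧ r' ≤ r ∧
      ∃ (R : Submodule ℂ (Metric.ball (0 : ℂ) r' → H)) (B : R →ₗ[ℂ] R →ₗ⋆[ℂ] ℂ),
        IsReproducingKernelKreinSpace
          (fun z w : Metric.ball (0 : ℂ) r' => K (z : ℂ) (w : ℂ)) R B := by
  have hconj : ∀ {ε : ℝ} {v : ℂ}, v ∈ Metric.ball (0 : ℂ) ε → conj v ∈ Metric.ball (0 : ℂ) ε :=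
    fun hv => by simpa using hv
  obtain ⟨ε, hε, hεr, M, a, ha, hsum⟩ := exists_double_power_series_of_separately_holomorphic
    (F := fun z v => K z (conj v)) hr (fun v hv => hHol.1 _ (hconj hv))
    (fun z hz => (hHol.2 z hz).mono fun v hv => hconj hv)
  -- In the variables z / s, w / s the coefficients are s^(m+n) a_{mn}, of norm at most M / 2^(m+n),
  -- hence summable.
  set s : ℝ := ε / 2 with hs
  have hs0 : 0 < s := by positivity
  set b : ℕ × ℕ → H →L[ℂ] H := fun p => ((s : ℂ) ^ (p.1 + p.2)) • a p with hb
  have hbs : Summable fun p => ‖b p‖ := by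
    have hg : Summable fun p : ℕ × ℕ => M * ((1 / 2 : ℝ) ^ p.1 * (1 / 2 : ℝ) ^ p.2) :=
      (summable_geometric_two.mul_of_nonneg summable_geometric_two
        (fun _ => by positivity) (fun _ => by positivity)).mul_left M
    refine Summable.of_nonneg_of_le (fun _ => norm_nonneg _) (fun p => ?_) hg
    rw [hb, norm_smul, norm_pow, Complex.norm_real, Real.norm_of_nonneg hs0.le]
    calc s ^ (p.1 + p.2) * ‖a p‖ ≤ s ^ (p.1 + p.2) * (M / ε ^ (p.1 + p.2)) := by
          gcongr; exact ha p
      _ = M * (1 / 2) ^ (p.1 + p.2) := by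
          rw [hs, div_pow, div_pow, one_pow]; field_simp
      _ = _ := by rw [pow_add]
  have hdiv : ∀ z ∈ Metric.ball (0 : ℂ) s, ‖z / s‖ < 1 := fun z hz => by
    rw [norm_div, Complex.norm_real, Real.norm_of_nonneg hs0.le, div_lt_one hs0]
    exact mem_ball_zero_iff.mp hz
  have hsub : Metric.ball (0 : ℂ) s ⊆ Metric.ball 0 ε := Metric.ball_subset_ball (by linarith)
  have hKb : ∀ z ∈ Metric.ball (0 : ℂ) s, ∀ w ∈ Metric.ball (0 : ℂ) s,
      K z w = evalPowerSeries H (z / s) ∘L operatorMatrix b ∘L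
        adjoint (evalPowerSeries H (w / s)) := by
    intro z hz w hw
    have h1 := hsum z (hsub hz) (conj w) (hconj (hsub hw))
    rw [Complex.conj_conj] at h1
    refine h1.unique ?_
    have h2 := hasSum_evalPowerSeries_operatorMatrix hbs (hdiv z hz) (hdiv w hw)
    have hterm : (fun p : ℕ × ℕ => ((z / s) ^ p.1 * conj (w / s) ^ p.2) • b p) =
        fun p => (z ^ p.1 * conj w ^ p.2) • a p := funext fun p => by
      rw [hb, smul_smul, map_div₀, Complex.conj_ofReal, div_pow, div_pow, pow_add]
      congr 1
      have : (s : ℂ) ≠ 0 := by exact_mod_cast hs0.ne'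
      field_simp
    rwa [hterm] at h2
  set A : SquareSummable H →L[ℂ] SquareSummable H :=
    (2⁻¹ : ℂ) • (operatorMatrix b + adjoint (operatorMatrix b)) with hA
  have hAsa : IsSelfAdjoint A := by
    rw [hA, IsSelfAdjoint, star_eq_adjoint, LinearIsometryEquiv.map_smulₛₗ, map_add,
      adjoint_adjoint, add_comm, map_inv₀, Complex.conj_ofNat]
  refine ⟨s, hs0, by linarith, exists_isReproducingKernelKreinSpace_of_factorization _ hAsa
    (fun x : Metric.ball (0 : ℂ) s => adjoint (evalPowerSeries H ((x : ℂ) / s))) ?_ ?_⟩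
  · intro g hg
    refine eq_zero_of_evalPowerSeries_eq_zero zero_lt_one fun z hz => ?_
    have hzs : z * s ∈ Metric.ball (0 : ℂ) s := by
      rw [mem_ball_zero_iff] at hz ⊢
      rw [norm_mul, Complex.norm_real, Real.norm_of_nonneg hs0.le]
      exact mul_lt_of_lt_one_left hs0 hz
    have := hg ⟨z * s, hzs⟩
    rwa [adjoint_adjoint, mul_div_cancel_right₀ _ (by exact_mod_cast hs0.ne')] at this
  · intro x y h
    have hsubr : Metric.ball (0 : ℂ) s ⊆ Metric.ball 0 r := hsub.trans (Metric.ball_subset_ball hεr)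
    have h1 := hKb x x.2 y y.2
    -- Hermitian symmetry gives the same factorization with the adjoint matrix; A is the average of
    -- the two.
    have h2 := hHerm x (hsubr x.2) y (hsubr y.2)
    rw [hKb y y.2 x x.2, adjoint_comp, adjoint_comp, adjoint_adjoint] at h2
    have h1' := DFunLike.congr_fun h1 h
    have h2' := DFunLike.congr_fun h2 h
    simp only [comp_apply] at h1' h2'
    rw [adjoint_adjoint, hA, smul_apply, add_apply, map_smul, map_add, ← h1', ← h2',
      ← two_smul ℂ, smul_smul]
    simp
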